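/- Let $a=\{a_n\}_{n\ge 1}$ and $b=\{b_n\}_{n\ge1}$ be non-increasing, summable sequences of positive real numbers, and write $r_n^{(a)}=\sum_{j\ge n}a_j$ and $r_n^{(b)}=\sum_{j\ge n}b_j$. Let $C_a\subset\mathbb R$ be the Cantor set obtained from a closed interval $I$ of length $\sum_{n\ge1}a_n$ as follows: remove from $I$ an open interval of length $a_1$; from the left and right remaining intervals remove open intervals of lengths $a_2$ and $a_3$, respectively; continue in this way, removing at step $k\ge 1$ gaps of lengths $a_{2^{k-1}},\dots,a_{2^k-1}$, from left to right, one from each of the $2^{k-1}$ remaining intervals. The position of each gap is the only one for which the length of every remaining interval equals the sum of the lengths of all gaps later removed from it. $C_b$ is defined from $b$ in the same way. A strictly increasing continuous function $h:(0,A]\to(0,\infty]$, where $A\ge r_1^{(a)}$, is said to be associated to $a$ if there are constants $c_1,c_2>0$ with $c_1/n\le h(r_n^{(a)}/n)\le c_2/n$ for all $n\ge1$; similarly for $b$. Let $h_a:(0,A]\to(0,\infty]$ be associated to $a$, let $h_b:(0,B]\to(0,\infty]$ be associated to $b$, and suppose that $h_a\equiv h_b$, that is, there are constants $c,c'>0$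 such that $h_a(x)\le c\,h_b(x)$ and $h_b(x)\le c'\,h_a(x)$ for all $x$ in the common domain $(0,\min(A,B)]$. Then $C_a$ and $C_b$ have the same Hausdorff dimension and the same packing dimension. Here the packing dimension of $E\subseteq\mathbb R$ is $\sup\{s>0: P^{s}(E)=\infty\}$ (with $\sup\emptyset=0$), where $P^{s}(E)=\inf\{\sum_{i\ge1}P^{s}_0(E_i): E=\bigcup_{i\ge1} E_i\}$ and $P_0^{s}(E)$ is the limit as $\delta\to0^+$ of the supremum of $\sum_i|B_i|^s$ over all disjoint families $\{B_i\}$ of open balls centred at points of $E$ with diameters $|B_i|<\delta$. -/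

import Mathlib

open scoped ENNReal NNReal

namespace GapCantor

noncomputable section

/-! ### Comparison of functions -/

/-- `f ≼ g` on `X`: there is a positive constant `c` with `f x ≤ c * g x` for all `x ∈ X`. -/
def Dominated {α : Type*} (X : Set α) (f g : α → ℝ≥0∞) : Prop :=
  ∃ c : ℝ≥0, 0 < c ∧ ∀ x ∈ X, f x ≤ (c : ℝ≥0∞) * g x

/-- `f ≡ g` on `X`: `f ≼ g` and `g ≼ f`. -/
def Equivalent {α : Type*} (X : Set α) (f g : α → ℝ≥0∞) : Prop :=
  Dominated X f g ∧ Dominated X g f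

/-! ### Sequences and associated functions

Sequences are indexed by `n = 1, 2, 3, …`; the value at `0` is never used. -/

/-- Positive, non-increasing, summable sequences `a 1, a 2, …`. -/
structure IsGapSequence (a : ℕ → ℝ) : Prop where
  pos : ∀ n, 1 ≤ n → 0 < a n
  anti : AntitoneOn a (Set.Ici 1)
  summable : Summable a

/-- The tail `r_n = ∑_{j ≥ n} a_j`. -/
def tail (a : ℕ → ℝ) (n : ℕ) : ℝ := ∑' j : ℕ, a (n + j)

/-- The increasing continuous function `h : (0, A] → (0, ∞]` is associated to `a`: the sequence
`h (r_n / n)` is equivalent to `1 / n`. Only the values of `h` on `(0, A]` matter, and the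
condition `tail a 1 ≤ A` says that all the points `r_n / n` lie in `(0, A]`. -/
structure IsAssociated (A : ℝ) (h : ℝ → ℝ≥0∞) (a : ℕ → ℝ) : Prop where
  domain : tail a 1 ≤ A
  pos : ∀ x ∈ Set.Ioc 0 A, 0 < h x
  increasing : StrictMonoOn h (Set.Ioc 0 A)
  continuousOn : ContinuousOn h (Set.Ioc 0 A)
  equivalent : Equivalent (Set.Ici 1) (fun n : ℕ => h (tail a n / n)) (fun n : ℕ => (n : ℝ≥0∞)⁻¹)

/-! ### The Cantor set with gaps `a`

The gap of length `a m` is removed from the interval number `m`; the two intervals that remain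
are number `2 * m` (left) and number `2 * m + 1` (right). The intervals of step `k` are those with
number `2 ^ k + j`, `0 ≤ j < 2 ^ k`, from left to right. -/

/-- The length of the interval number `m`: the sum of all the gaps `a (m * 2 ^ i + l)`, `l < 2 ^ i`,
that are removed from inside it. -/
def intervalLength (a : ℕ → ℝ) (m : ℕ) : ℝ :=
  ∑' i : ℕ, ∑ l ∈ Finset.range (2 ^ i), a (m * 2 ^ i + l)

/-- The left endpoint of the `j`-th interval (`0 ≤ j < 2 ^ k`) of step `k`, when the construction
starts from an interval with left endpoint `u`. The interval `j` of step `k + 1` lies in the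
interval `j / 2` of step `k`, to the left of its gap if `j` is even, and to the right otherwise. -/
def intervalLeft (u : ℝ) (a : ℕ → ℝ) : ℕ → ℕ → ℝ
  | 0, _ => u
  | k + 1, j =>
    if j % 2 = 0 then intervalLeft u a k (j / 2)
    else intervalLeft u a k (j / 2) + intervalLength a (2 * (2 ^ k + j / 2)) + a (2 ^ k + j / 2)

/-- The `j`-th closed interval of step `k`. -/
def stepInterval (u : ℝ) (a : ℕ → ℝ) (k j : ℕ) : Set ℝ :=
  Set.Icc (intervalLeft u a k j) (intervalLeft u a k j + intervalLength a (2 ^ k + j))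

/-- The Cantor set `C_a` constructed in the interval `[u, u + ∑ a_n]`. -/
def cantorSet (u : ℝ) (a : ℕ → ℝ) : Set ℝ :=
  ⋂ k : ℕ, ⋃ j ∈ Finset.range (2 ^ k), stepInterval u a k j

/-! ### Packing measures and packing dimension -/

/-- A `δ`-packing of `E ⊆ ℝ`: a disjoint family of open balls (given by centre and radius) centred
at points of `E`, with diameters less than `δ`. -/
def IsPacking (δ : ℝ) (E : Set ℝ) (T : Set (ℝ × ℝ)) : Prop :=
  (∀ p ∈ T, p.1 ∈ E ∧ 0 < p.2 ∧ 2 * p.2 < δ) ∧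
    T.PairwiseDisjoint fun p => Metric.ball p.1 p.2

/-- The `h`-packing pre-measure. The supremum is monotone in `δ`, so that its limit as `δ → 0+` is
its infimum over `δ > 0`. -/
def packingPremeasure (h : ℝ → ℝ≥0∞) (E : Set ℝ) : ℝ≥0∞ :=
  ⨅ (δ : ℝ) (_ : 0 < δ), ⨆ (T : Set (ℝ × ℝ)) (_ : IsPacking δ E T), ∑' p : T, h (2 * p.1.2)

/-- The `h`-packing measure. -/
def packingMeasure (h : ℝ → ℝ≥0∞) (E : Set ℝ) : ℝ≥0∞ :=
  ⨅ (F : ℕ → Set ℝ) (_ : E = ⋃ i, F i), ∑' i, packingPremeasure h (F i)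

/-- The packing dimension: the supremum of the `s > 0` such that the packing measure for
`h_s (x) = x ^ s` is infinite (`0` if there is no such `s`). -/
def packingDim (E : Set ℝ) : ℝ≥0∞ :=
  ⨆ (s : ℝ≥0) (_ : 0 < s)
    (_ : packingMeasure (fun x => ENNReal.ofReal (x ^ (s : ℝ))) E = ∞), (s : ℝ≥0∞)

end

end GapCantor

open Filter Topology MeasureTheory

namespace GapCantor

/-! ### Interval lengths and their averages. -/

section Lengths

variable {a : ℕ → ℝ}

/-! Both dimensions of `C_a` can be read off from the numbers `L_k = maxLength a k` through `stepSum
a s k = 2 ^ k * L_k ^ s`. Since `a` is non-increasing, every interval of step `k` has length between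
`L_{k+1}` and `L_k`, so the set is homogeneous up to a shift of one step.

Covering by step intervals bounds the Hausdorff measure by the liminf of `stepSum`. Conversely, if
`stepSum` stays away from `0`, the inverse of the binary coding `[0, 1) → C_a` is `s`-Hölder, and `s
≤ dimH`. The `s`-packing measure is finite if `stepSum` is bounded (volume count under the coding)
and infinite otherwise (Baire category).

The lengths of step `k` sum to `r_{2^k}`, so averaging gives `L_{k+1} ≤ r_{2^k} / 2^k ≤ L_k`.
Associated functions are of order `2^{-k}` at these averages; if they are equivalent, monotonicity
gives `L^a_{k+m} ≤ L^b_k` for a fixed `m` and all large `k` (`exists_maxLength_le`). A shift by `m`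
changes `stepSum` by at most the factor `2 ^ m`, so the dimensions compare, and symmetry finishes.
-/

theorem IsGapSequence.nonneg (ha : IsGapSequence a) {n : ℕ} (hn : 1 ≤ n) : 0 ≤ a n :=
  (ha.pos n hn).le

/-- The index blocks `[m * 2 ^ i, m * 2 ^ i + 2 ^ i)` are disjoint because each ends at or before `m
* 2 ^ (i + 1)`. This makes the series defining `intervalLength` converge. -/
theorem IsGapSequence.sum_blocks_le (ha : IsGapSequence a) {m : ℕ} (hm : 1 ≤ m) (N : ℕ) :
    ∑ i ∈ Finset.range N, ∑ l ∈ Finset.range (2 ^ i), a (m * 2 ^ i + l) ≤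
      ∑ n ∈ Finset.Ico m (m * 2 ^ N), a n := by
  induction N with
  | zero => simp
  | succ N ih =>
    have hpos : 0 < 2 ^ N := by positivity
    have h1 : m * 2 ^ N + 2 ^ N ≤ m * 2 ^ (N + 1) := by
      rw [pow_succ]; nlinarith
    have h2 : m ≤ m * 2 ^ N := by nlinarith
    rw [Finset.sum_range_succ, ← Finset.sum_Ico_consecutive a h2 (by omega : _ ≤ m * 2 ^ (N + 1))]
    refine add_le_add ih ?_
    have h3 : ∑ l ∈ Finset.range (2 ^ N), a (m * 2 ^ N + l) =
        ∑ n ∈ Finset.Ico (m * 2 ^ N) (m * 2 ^ N + 2 ^ N), a n := by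
      rw [Finset.sum_Ico_eq_sum_range]; simp
    rw [h3]
    refine Finset.sum_le_sum_of_subset_of_nonneg
      (Finset.Ico_subset_Ico le_rfl h1) fun i hi _ => ha.nonneg ?_
    have := (Finset.mem_Ico.1 hi).1
    omega

theorem IsGapSequence.block_nonneg (ha : IsGapSequence a) {m : ℕ} (hm : 1 ≤ m) (i : ℕ) :
    0 ≤ ∑ l ∈ Finset.range (2 ^ i), a (m * 2 ^ i + l) :=
  Finset.sum_nonneg fun l _ => ha.nonneg
    (Nat.le_add_right_of_le (Nat.mul_pos hm (by positivity)))

theorem IsGapSequence.summable_blocks (ha : IsGapSequence a) {m : ℕ} (hm : 1 ≤ m) :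
    Summable fun i : ℕ => ∑ l ∈ Finset.range (2 ^ i), a (m * 2 ^ i + l) := by
  have hs : Summable fun n => a (m + n) := by
    simpa only [add_comm] using (summable_nat_add_iff m).2 ha.summable
  refine summable_of_sum_range_le (c := ∑' n, a (m + n)) (ha.block_nonneg hm) fun N => ?_
  refine (ha.sum_blocks_le hm N).trans ?_
  rw [Finset.sum_Ico_eq_sum_range]
  exact hs.sum_le_tsum _ fun i _ => ha.nonneg (by omega)

theorem IsGapSequence.intervalLength_nonneg (ha : IsGapSequence a) {m : ℕ} (hm : 1 ≤ m) :
    0 ≤ intervalLength a m :=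
  tsum_nonneg (ha.block_nonneg hm)

/-- The block of level `i + 1` below `m` splits into halves, which are the blocks of level `i` below
`2 * m` and `2 * m + 1`. -/
theorem IsGapSequence.intervalLength_eq (ha : IsGapSequence a) {m : ℕ} (hm : 1 ≤ m) :
    intervalLength a m =
      a m + intervalLength a (2 * m) + intervalLength a (2 * m + 1) := by
  have h2 := ha.summable_blocks (show 1 ≤ 2 * m by omega)
  have h3 := ha.summable_blocks (show 1 ≤ 2 * m + 1 by omega)
  unfold intervalLength
  rw [(ha.summable_blocks hm).tsum_eq_zero_add, add_assoc, ← h2.tsum_add h3]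
  congr 1
  · simp
  · refine tsum_congr fun i => ?_
    rw [pow_succ, mul_two, Finset.sum_range_add]
    congr 1 <;> refine Finset.sum_congr rfl fun l _ => ?_ <;> congr 1 <;> ring

theorem IsGapSequence.intervalLength_pos (ha : IsGapSequence a) {m : ℕ} (hm : 1 ≤ m) :
    0 < intervalLength a m := by
  rw [ha.intervalLength_eq hm]
  have := ha.pos m hm
  have := ha.intervalLength_nonneg (show 1 ≤ 2 * m by omega)
  have := ha.intervalLength_nonneg (show 1 ≤ 2 * m + 1 by omega)
  linarith

theorem IsGapSequence.intervalLength_anti (ha : IsGapSequence a) {m n : ℕ} (hm : 1 ≤ m)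
    (hmn : m ≤ n) : intervalLength a n ≤ intervalLength a m := by
  refine Summable.tsum_le_tsum (fun i => Finset.sum_le_sum fun l _ => ?_)
    (ha.summable_blocks (hm.trans hmn)) (ha.summable_blocks hm)
  have h1 : 1 ≤ m * 2 ^ i := Nat.mul_pos hm (by positivity)
  have h2 : m * 2 ^ i ≤ n * 2 ^ i := Nat.mul_le_mul_right _ hmn
  exact ha.anti (Set.mem_Ici.2 (by omega)) (Set.mem_Ici.2 (by omega)) (by omega)

/-- The gaps removed after step `k` are exactly the `a n` with `n ≥ 2 ^ k`: the blocks of level `i`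
together fill `[2 ^ (k + i), 2 ^ (k + i + 1))`. -/
theorem IsGapSequence.sum_intervalLength (ha : IsGapSequence a) (k : ℕ) :
    ∑ j ∈ Finset.range (2 ^ k), intervalLength a (2 ^ k + j) = tail a (2 ^ k) := by
  have hone : ∀ j, 1 ≤ 2 ^ k + j := fun j => Nat.le_add_right_of_le Nat.one_le_two_pow
  have hs : Summable fun n => a (2 ^ k + n) := by
    simpa only [add_comm] using (summable_nat_add_iff (2 ^ k)).2 ha.summable
  have hblock : ∀ i : ℕ, ∑ j ∈ Finset.range (2 ^ k), ∑ l ∈ Finset.range (2 ^ i),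
      a ((2 ^ k + j) * 2 ^ i + l) = ∑ n ∈ Finset.Ico (2 ^ (k + i)) (2 ^ (k + (i + 1))), a n := by
    intro i
    have key : ∀ N, ∑ j ∈ Finset.range N, ∑ l ∈ Finset.range (2 ^ i),
        a ((2 ^ k + j) * 2 ^ i + l) =
          ∑ n ∈ Finset.range (N * 2 ^ i), a (2 ^ (k + i) + n) := by
      intro N
      induction N with
      | zero => simp
      | succ N ih =>
        rw [Finset.sum_range_succ, ih, Nat.add_one_mul N, Finset.sum_range_add]
        congr 1
        refine Finset.sum_congr rfl fun l _ => ?_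
        congr 1; ring
    rw [key, Finset.sum_Ico_eq_sum_range]
    congr 2
    rw [← add_assoc, pow_succ (2 : ℕ) (k + i), pow_add]
    omega
  have hpart : ∀ N, ∑ i ∈ Finset.range N, ∑ n ∈ Finset.Ico (2 ^ (k + i)) (2 ^ (k + (i + 1))), a n =
      ∑ n ∈ Finset.range (2 ^ (k + N) - 2 ^ k), a (2 ^ k + n) := by
    intro N
    rw [← Finset.sum_Ico_eq_sum_range]
    induction N with
    | zero => simp
    | succ N ih =>
      rw [Finset.sum_range_succ, ih, Finset.sum_Ico_consecutive]
      · exact Nat.pow_le_pow_right (by norm_num) (by omega)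
      · exact Nat.pow_le_pow_right (by norm_num) (by omega)
  unfold intervalLength
  rw [← Summable.tsum_finsetSum fun j _ => ha.summable_blocks (hone j)]
  simp_rw [hblock]
  have hsum : Summable fun i => ∑ n ∈ Finset.Ico (2 ^ (k + i)) (2 ^ (k + (i + 1))), a n := by
    simp_rw [← hblock]
    exact summable_sum fun j _ => ha.summable_blocks (hone j)
  -- The partial sums over levels form a subsequence of the partial sums of the tail.
  refine tendsto_nhds_unique hsum.hasSum.tendsto_sum_nat ?_
  simp_rw [hpart]
  refine hs.hasSum.tendsto_sum_nat.comp ?_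
  refine tendsto_atTop_mono (fun N => ?_) tendsto_id
  have h1 : N < 2 ^ N := Nat.lt_two_pow_self
  have h2 : 1 ≤ 2 ^ k := Nat.one_le_two_pow
  have h3 : 2 ^ k * (N + 1) ≤ 2 ^ k * 2 ^ N := Nat.mul_le_mul_left _ h1
  rw [pow_add]
  simp only [id]
  have h4 : N ≤ 2 ^ k * N := Nat.le_mul_of_pos_left _ h2
  rw [mul_add] at h3
  omega

/-- The length of the leftmost interval of step `k`, which is the longest one. -/
noncomputable def maxLength (a : ℕ → ℝ) (k : ℕ) : ℝ := intervalLength a (2 ^ k)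

theorem IsGapSequence.maxLength_pos (ha : IsGapSequence a) (k : ℕ) : 0 < maxLength a k :=
  ha.intervalLength_pos Nat.one_le_two_pow

theorem IsGapSequence.intervalLength_le_maxLength (ha : IsGapSequence a) (k j : ℕ) :
    intervalLength a (2 ^ k + j) ≤ maxLength a k :=
  ha.intervalLength_anti Nat.one_le_two_pow (by omega)

/-- The leftmost interval of step `k + 1` has number `2 ^ (k + 1)`, which exceeds every number of
step `k`. -/
theorem IsGapSequence.maxLength_succ_le (ha : IsGapSequence a) {k j : ℕ} (hj : j < 2 ^ k) :
    maxLength a (k + 1) ≤ intervalLength a (2 ^ k + j) :=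
  ha.intervalLength_anti (Nat.le_add_right_of_le Nat.one_le_two_pow) (by rw [pow_succ]; omega)

theorem IsGapSequence.tail_le_maxLength (ha : IsGapSequence a) (k : ℕ) :
    tail a (2 ^ k) / 2 ^ k ≤ maxLength a k := by
  rw [div_le_iff₀ (by positivity), ← ha.sum_intervalLength k]
  refine (Finset.sum_le_card_nsmul _ _ _ fun j _ => ha.intervalLength_le_maxLength k j).trans ?_
  simp [mul_comm]

theorem IsGapSequence.maxLength_succ_le_tail (ha : IsGapSequence a) (k : ℕ) :
    maxLength a (k + 1) ≤ tail a (2 ^ k) / 2 ^ k := by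
  rw [le_div_iff₀ (by positivity), ← ha.sum_intervalLength k]
  refine le_trans ?_ (Finset.card_nsmul_le_sum _ _ _ fun j hj =>
    ha.maxLength_succ_le (Finset.mem_range.1 hj))
  simp [mul_comm]

theorem IsGapSequence.tail_pos (ha : IsGapSequence a) {n : ℕ} (hn : 1 ≤ n) : 0 < tail a n := by
  have hs : Summable fun j => a (n + j) := by
    simpa only [add_comm] using (summable_nat_add_iff n).2 ha.summable
  exact hs.tsum_pos (fun j => ha.nonneg (by omega)) 0 (ha.pos _ (by omega))

theorem IsGapSequence.tail_le_tail_one (ha : IsGapSequence a) {n : ℕ} (hn : 1 ≤ n) :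
    tail a n ≤ tail a 1 := by
  have hs : Summable fun j => a (1 + j) := by
    simpa only [add_comm] using (summable_nat_add_iff 1).2 ha.summable
  have hinj : Function.Injective fun j : ℕ => n - 1 + j := fun i j h => by simpa using h
  have heq : tail a n = ∑' j, (fun j => a (1 + j)) (n - 1 + j) :=
    tsum_congr fun j => congrArg a (by omega)
  rw [heq]
  exact tsum_comp_le_tsum_of_inj hs (fun j => ha.nonneg (by omega)) hinj

theorem IsGapSequence.tendsto_tail_div (ha : IsGapSequence a) :
    Tendsto (fun k : ℕ => tail a (2 ^ k) / 2 ^ k) atTop (𝓝 0) := by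
  have h : Tendsto (fun k : ℕ => tail a 1 / 2 ^ k) atTop (𝓝 0) :=
    tendsto_const_nhds.div_atTop (tendsto_pow_atTop_atTop_of_one_lt one_lt_two)
  refine squeeze_zero (fun k => ?_) (fun k => ?_) h
  · exact div_nonneg (ha.tail_pos Nat.one_le_two_pow).le (by positivity)
  · gcongr
    exact ha.tail_le_tail_one Nat.one_le_two_pow

theorem IsGapSequence.tendsto_maxLength (ha : IsGapSequence a) :
    Tendsto (maxLength a) atTop (𝓝 0) := by
  rw [← tendsto_add_atTop_iff_nat 1]
  exact squeeze_zero (fun k => (ha.maxLength_pos _).le) ha.maxLength_succ_le_tail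
    ha.tendsto_tail_div

end Lengths

/-! ### Position of the intervals and the binary coding. -/

section Intervals

variable {a : ℕ → ℝ} {u : ℝ}

/-- Siblings are separated by the gap of their parent. Otherwise the two intervals abut the facing
ends of neighbouring parents, and induction applies. -/
theorem IsGapSequence.right_le_left_succ (ha : IsGapSequence a) (k : ℕ) {j : ℕ}
    (hj : j + 1 < 2 ^ k) :
    intervalLeft u a k j + intervalLength a (2 ^ k + j) ≤ intervalLeft u a k (j + 1) := by
  induction k generalizing j with
  | zero => simp at hj
  | succ k ih =>
    have hone : ∀ i, 1 ≤ 2 ^ k + i := fun i => Nat.le_add_right_of_le Nat.one_le_two_pow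
    have hp : 2 ^ (k + 1) = 2 * 2 ^ k := by rw [pow_succ, mul_comm]
    obtain ⟨i, rfl | rfl⟩ := Nat.even_or_odd' j
    · have e1 : (2 * i + 1) / 2 = i := by omega
      have e2 : 2 ^ (k + 1) + 2 * i = 2 * (2 ^ k + i) := by omega
      have := ha.nonneg (hone i)
      simp [intervalLeft, e1, e2]
      linarith
    · have e1 : (2 * i + 1) / 2 = i := by omega
      have e2 : 2 ^ (k + 1) + (2 * i + 1) = 2 * (2 ^ k + i) + 1 := by omega
      have e3 : (2 * i + 1 + 1) / 2 = i + 1 := by omega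
      have e4 : (2 * i + 1 + 1) % 2 = 0 := by omega
      have h := ih (j := i) (by omega)
      rw [ha.intervalLength_eq (hone i)] at h
      simp [intervalLeft, e1, e2, e3, e4]
      linarith

theorem IsGapSequence.right_le_left (ha : IsGapSequence a) (k : ℕ) {i j : ℕ} (hij : i < j)
    (hj : j < 2 ^ k) :
    intervalLeft u a k i + intervalLength a (2 ^ k + i) ≤ intervalLeft u a k j := by
  induction j, hij using Nat.le_induction with
  | base => exact ha.right_le_left_succ k hj
  | succ j hij ih =>
    have := ha.intervalLength_nonneg
      (show 1 ≤ 2 ^ k + j from Nat.le_add_right_of_le Nat.one_le_two_pow)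
    linarith [ih (by omega), ha.right_le_left_succ (u := u) k hj]

theorem IsGapSequence.stepInterval_succ_subset (ha : IsGapSequence a) (k j : ℕ) :
    stepInterval u a (k + 1) j ⊆ stepInterval u a k (j / 2) := by
  have hone : ∀ i, 1 ≤ 2 ^ k + i := fun i => Nat.le_add_right_of_le Nat.one_le_two_pow
  have hp : 2 ^ (k + 1) = 2 * 2 ^ k := by rw [pow_succ, mul_comm]
  have h := ha.intervalLength_eq (hone (j / 2))
  have h0 := ha.nonneg (hone (j / 2))
  have h1 := ha.intervalLength_nonneg (show 1 ≤ 2 * (2 ^ k + j / 2) by have := hone 0; omega)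
  have h2 := ha.intervalLength_nonneg (show 1 ≤ 2 * (2 ^ k + j / 2) + 1 by omega)
  rcases Nat.mod_two_eq_zero_or_one j with hj | hj
  · have e : 2 ^ (k + 1) + j = 2 * (2 ^ k + j / 2) := by omega
    refine Set.Icc_subset_Icc ?_ ?_ <;> simp only [intervalLeft, hj, e] <;> simp
    linarith
  · have e : 2 ^ (k + 1) + j = 2 * (2 ^ k + j / 2) + 1 := by omega
    refine Set.Icc_subset_Icc ?_ ?_ <;> simp only [intervalLeft, hj, e] <;> simp <;> linarith

theorem IsGapSequence.stepInterval_add_subset (ha : IsGapSequence a) (k d j : ℕ) :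
    stepInterval u a (k + d) j ⊆ stepInterval u a k (j / 2 ^ d) := by
  induction d generalizing j with
  | zero => simp
  | succ d ih =>
    refine (ha.stepInterval_succ_subset (k + d) j).trans ((ih (j / 2)).trans ?_)
    rw [Nat.div_div_eq_div_mul, pow_succ, mul_comm]

theorem isCompact_stepInterval (k j : ℕ) : IsCompact (stepInterval u a k j) := isCompact_Icc

theorem isClosed_cantorSet : IsClosed (cantorSet u a) :=
  isClosed_iInter fun _ => Set.Finite.isClosed_biUnion (Finset.finite_toSet _)
    fun _ _ => isClosed_Icc

theorem mem_cantorSet_iff {x : ℝ} :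
    x ∈ cantorSet u a ↔ ∀ k, ∃ j < 2 ^ k, x ∈ stepInterval u a k j := by
  simp [cantorSet]

theorem IsGapSequence.stepInterval_nonempty (ha : IsGapSequence a) (k j : ℕ) :
    (stepInterval u a k j).Nonempty :=
  Set.nonempty_Icc.2 (le_add_of_nonneg_right
    (ha.intervalLength_nonneg (Nat.le_add_right_of_le Nat.one_le_two_pow)))

/-- Points of intervals of step `k` that are not neighbours are at distance at least the length of
the interval in between. -/
theorem IsGapSequence.maxLength_le_sub (ha : IsGapSequence a) {k i j : ℕ} {x y : ℝ}
    (hij : i + 2 ≤ j) (hj : j < 2 ^ k) (hx : x ∈ stepInterval u a k i)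
    (hy : y ∈ stepInterval u a k j) : maxLength a (k + 1) ≤ y - x := by
  have h1 := ha.right_le_left (u := u) k (show i < i + 1 by omega) (by omega)
  have h2 := ha.right_le_left (u := u) k (show i + 1 < j by omega) hj
  have h3 := ha.maxLength_succ_le (show i + 1 < 2 ^ k by omega)
  linarith [hx.2, hy.1]

theorem floor_mul_two_pow_lt {y : ℝ} (hy : y ∈ Set.Ico (0 : ℝ) 1) (k : ℕ) :
    ⌊y * 2 ^ k⌋₊ < 2 ^ k := by
  rw [Nat.floor_lt (mul_nonneg hy.1 (by positivity))]
  push_cast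
  exact mul_lt_of_lt_one_left (by positivity) hy.2

/-- Halving the index `⌊y * 2 ^ (k + 1)⌋₊` gives `⌊y * 2 ^ k⌋₊`, so the intervals are nested and
compact. Neither nesting nor non-emptiness needs the index to be below `2 ^ k`, hence `y` is
arbitrary. -/
theorem IsGapSequence.exists_mem_iInter_stepInterval (ha : IsGapSequence a) (u y : ℝ) :
    ∃ x, ∀ k : ℕ, x ∈ stepInterval u a k ⌊y * 2 ^ k⌋₊ := by
  have hdiv : ∀ k : ℕ, ⌊y * 2 ^ (k + 1)⌋₊ / 2 = ⌊y * 2 ^ k⌋₊ := fun k => by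
    rw [← Nat.floor_div_ofNat]
    congr 1
    rw [pow_succ]; ring
  obtain ⟨x, hx⟩ := IsCompact.nonempty_iInter_of_sequence_nonempty_isCompact_isClosed
    (fun k : ℕ => stepInterval u a k ⌊y * 2 ^ k⌋₊)
    (fun k => by
      have := ha.stepInterval_succ_subset (u := u) k ⌊y * 2 ^ (k + 1)⌋₊
      rwa [hdiv] at this)
    (fun k => ha.stepInterval_nonempty k _) (isCompact_stepInterval _ _) (fun k => isClosed_Icc)
  exact ⟨x, Set.mem_iInter.1 hx⟩

/-- A map of `[0, 1)` into the Cantor set that sends dyadic intervals of order `k` into intervals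
of step `k`. -/
theorem IsGapSequence.exists_coding (ha : IsGapSequence a) (u : ℝ) :
    ∃ g : ℝ → ℝ, (∀ y ∈ Set.Ico (0 : ℝ) 1, g y ∈ cantorSet u a) ∧
      ∀ y, ∀ k : ℕ, g y ∈ stepInterval u a k ⌊y * 2 ^ k⌋₊ := by
  choose g hg using ha.exists_mem_iInter_stepInterval u
  exact ⟨g, fun y hy => mem_cantorSet_iff.2 fun k => ⟨_, floor_mul_two_pow_lt hy k, hg y k⟩, hg⟩

theorem IsGapSequence.cantorSet_inter_stepInterval_nonempty (ha : IsGapSequence a) {k j : ℕ}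
    (hj : j < 2 ^ k) : (cantorSet u a ∩ stepInterval u a k j).Nonempty := by
  obtain ⟨g, hgC, hg⟩ := ha.exists_coding u
  have hp : (0 : ℝ) < 2 ^ k := by positivity
  refine ⟨g (j / 2 ^ k), hgC _ ⟨by positivity, ?_⟩, ?_⟩
  · rw [div_lt_one hp]; exact_mod_cast hj
  · have := hg (j / 2 ^ k) k
    rwa [div_mul_cancel₀ _ hp.ne', Nat.floor_natCast] at this

end Intervals

/-! ### Hausdorff dimension through `stepSum`. -/

section Hausdorff

variable {a : ℕ → ℝ} {u : ℝ}

/-- The sum of the `s`-th powers of `2 ^ k` copies of the longest interval of step `k`. -/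
noncomputable def stepSum (a : ℕ → ℝ) (s : ℝ) (k : ℕ) : ℝ := 2 ^ k * maxLength a k ^ s

theorem IsGapSequence.stepSum_pos (ha : IsGapSequence a) (s : ℝ) (k : ℕ) : 0 < stepSum a s k :=
  mul_pos (by positivity) (Real.rpow_pos_of_pos (ha.maxLength_pos k) s)

theorem IsGapSequence.hausdorffMeasure_le_liminf (ha : IsGapSequence a) {s : ℝ} (hs : 0 ≤ s) :
    μH[s] (cantorSet u a) ≤ liminf (fun k => ENNReal.ofReal (stepSum a s k)) atTop := by
  have hdiam : ∀ k (j : Fin (2 ^ k)),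
      Metric.ediam (stepInterval u a k j) ≤ ENNReal.ofReal (maxLength a k) := by
    intro k j
    rw [stepInterval, Real.ediam_Icc]
    refine ENNReal.ofReal_le_ofReal ?_
    rw [add_sub_cancel_left]
    exact ha.intervalLength_le_maxLength k j
  refine (Measure.hausdorffMeasure_le_liminf_sum s (cantorSet u a) (l := atTop)
    (fun k => ENNReal.ofReal (maxLength a k)) ?_
    (fun k (j : Fin (2 ^ k)) => stepInterval u a k j) (Eventually.of_forall hdiam)
    (Eventually.of_forall fun k x hx => ?_)).trans (liminf_le_liminf ?_)
  · simpa using ENNReal.tendsto_ofReal ha.tendsto_maxLength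
  · obtain ⟨j, hj, hxj⟩ := mem_cantorSet_iff.1 hx k
    exact Set.mem_iUnion.2 ⟨⟨j, hj⟩, hxj⟩
  · refine Eventually.of_forall fun k => ?_
    refine (Finset.sum_le_card_nsmul _ _ _ fun j _ =>
      ENNReal.rpow_le_rpow (hdiam k j) hs).trans ?_
    rw [stepSum, ENNReal.ofReal_mul (by positivity),
      ENNReal.ofReal_rpow_of_nonneg (ha.maxLength_pos k).le hs]
    simp [ENNReal.ofReal_pow]

theorem IsGapSequence.exists_le_stepSum_of_hausdorffMeasure_ne_zero (ha : IsGapSequence a) {s : ℝ}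
    (hs : 0 ≤ s) (h : μH[s] (cantorSet u a) ≠ 0) :
    ∃ c > 0, ∀ᶠ k in atTop, c ≤ stepSum a s k := by
  obtain ⟨c, hc0, hc⟩ := exists_between
    ((pos_iff_ne_zero.2 h).trans_le (ha.hausdorffMeasure_le_liminf hs))
  have hctop : c ≠ ∞ := (hc.trans_le le_top).ne
  refine ⟨c.toReal, ENNReal.toReal_pos hc0.ne' hctop, ?_⟩
  filter_upwards [eventually_lt_of_lt_liminf hc] with k hk
  exact (ENNReal.lt_ofReal_iff_toReal_lt hctop).1 hk |>.le

/-- Only finitely many terms are left, all positive; passing to inverses turns this into boundedness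
of an eventually bounded sequence. -/
theorem IsGapSequence.exists_forall_le_stepSum (ha : IsGapSequence a) {s : ℝ}
    (h : ∃ c > 0, ∀ᶠ k in atTop, c ≤ stepSum a s k) : ∃ c > 0, ∀ k, c ≤ stepSum a s k := by
  obtain ⟨c, hc, hk⟩ := h
  have hb : IsBoundedUnder (· ≤ ·) atTop fun k => (stepSum a s k)⁻¹ :=
    ⟨c⁻¹, eventually_map.2 (hk.mono fun k hk => inv_anti₀ hc hk)⟩
  obtain ⟨M, hM⟩ := hb.bddAbove_range
  have hM' : ∀ k, (stepSum a s k)⁻¹ ≤ M := fun k => hM ⟨k, rfl⟩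
  have hMpos : 0 < M := (inv_pos.2 (ha.stepSum_pos s 0)).trans_le (hM' 0)
  exact ⟨M⁻¹, inv_pos.2 hMpos, fun k => inv_le_of_inv_le₀ (ha.stepSum_pos s k) (hM' k)⟩

theorem abs_sub_le_of_floor {x y : ℝ} (hx : 0 ≤ x) (hy : 0 ≤ y)
    (h : ⌊x⌋₊ < ⌊y⌋₊ + 2) (h' : ⌊y⌋₊ < ⌊x⌋₊ + 2) : |x - y| ≤ 2 := by
  have h1 := Nat.floor_le hx
  have h2 := Nat.floor_le hy
  have h3 := Nat.lt_floor_add_one x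
  have h4 := Nat.lt_floor_add_one y
  have h5 : (⌊x⌋₊ : ℝ) ≤ ⌊y⌋₊ + 1 := by exact_mod_cast (by omega : ⌊x⌋₊ ≤ ⌊y⌋₊ + 1)
  have h6 : (⌊y⌋₊ : ℝ) ≤ ⌊x⌋₊ + 1 := by exact_mod_cast (by omega : ⌊y⌋₊ ≤ ⌊x⌋₊ + 1)
  rw [abs_le]; constructor <;> linarith

/-- If the dyadic indices of `x` and `y` differed by at least `2`, a whole interval of step `k`
would separate `g x` from `g y`. -/
theorem IsGapSequence.abs_sub_le_of_coding (ha : IsGapSequence a) {g : ℝ → ℝ}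
    (hg : ∀ y, ∀ k : ℕ, g y ∈ stepInterval u a k ⌊y * 2 ^ k⌋₊) {x y : ℝ}
    (hx : x ∈ Set.Ico (0 : ℝ) 1) (hy : y ∈ Set.Ico (0 : ℝ) 1) {k : ℕ}
    (h : |g x - g y| < maxLength a (k + 1)) : |x - y| ≤ 2 / 2 ^ k := by
  have key : ∀ {x y : ℝ}, y ∈ Set.Ico (0 : ℝ) 1 → |g x - g y| < maxLength a (k + 1) →
      ⌊y * 2 ^ k⌋₊ < ⌊x * 2 ^ k⌋₊ + 2 := by
    intro x y hy h
    by_contra! hlt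
    have := ha.maxLength_le_sub hlt (floor_mul_two_pow_lt hy k) (hg x k) (hg y k)
    linarith [neg_le_abs (g x - g y)]
  have hp : (0 : ℝ) < 2 ^ k := by positivity
  have := abs_sub_le_of_floor (mul_nonneg hx.1 hp.le) (mul_nonneg hy.1 hp.le)
    (key hx (by rwa [abs_sub_comm])) (key hy h)
  rwa [← sub_mul, abs_mul, abs_of_pos hp, ← le_div_iff₀ hp] at this

theorem IsGapSequence.eq_of_coding_eq (ha : IsGapSequence a) {g : ℝ → ℝ}
    (hg : ∀ y, ∀ k : ℕ, g y ∈ stepInterval u a k ⌊y * 2 ^ k⌋₊) {x y : ℝ}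
    (hx : x ∈ Set.Ico (0 : ℝ) 1) (hy : y ∈ Set.Ico (0 : ℝ) 1) (h : g x = g y) : x = y := by
  have hlim : Tendsto (fun k : ℕ => (2 : ℝ) / 2 ^ k) atTop (𝓝 0) :=
    tendsto_const_nhds.div_atTop (tendsto_pow_atTop_atTop_of_one_lt one_lt_two)
  have : |x - y| ≤ 0 := ge_of_tendsto' hlim fun k =>
    ha.abs_sub_le_of_coding hg hx hy (by simpa [h] using ha.maxLength_pos (k + 1))
  exact sub_eq_zero.1 (abs_nonpos_iff.1 this)

/-- The inverse of the coding is Hölder continuous. -/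
theorem IsGapSequence.abs_sub_le_rpow (ha : IsGapSequence a) {g : ℝ → ℝ}
    (hg : ∀ y, ∀ k : ℕ, g y ∈ stepInterval u a k ⌊y * 2 ^ k⌋₊) {s c : ℝ} (hs : 0 < s)
    (hc : 0 < c) (hck : ∀ k, c ≤ stepSum a s k) {x y : ℝ}
    (hx : x ∈ Set.Ico (0 : ℝ) 1) (hy : y ∈ Set.Ico (0 : ℝ) 1) :
    |x - y| ≤ 8 / c * |g x - g y| ^ s := by
  rcases eq_or_ne x y with rfl | hne
  · simp [hs.ne']
  have hd : 0 < |g x - g y| :=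
    abs_pos.2 (sub_ne_zero.2 fun h => hne (ha.eq_of_coding_eq hg hx hy h))
  have hex : ∃ k, maxLength a k ≤ |g x - g y| :=
    ((ha.tendsto_maxLength.eventually_lt_const hd).mono fun _ h => h.le).exists
  classical
  have hfind := Nat.find_spec hex
  have hmin := fun m => Nat.find_min hex (m := m)
  generalize Nat.find hex = n at hfind hmin
  -- By minimality of `n`, `|g x - g y| < maxLength a (n - 1)`, so the previous estimate with `k = n
  -- - 2` gives `2 / 2 ^ (n - 2)`. For `n ≤ 1` the bound is trivial on `[0, 1)`.
  have hxy : |x - y| ≤ 8 / 2 ^ n := by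
    rcases n with _ | _ | k
    · have := hx.1; have := hx.2; have := hy.1; have := hy.2
      rw [abs_le]; constructor <;> norm_num <;> linarith
    · have := hx.1; have := hx.2; have := hy.1; have := hy.2
      rw [abs_le]; constructor <;> norm_num <;> linarith
    · refine (ha.abs_sub_le_of_coding hg hx hy (k := k) (not_le.1 (hmin _ (by omega)))).trans ?_
      rw [pow_succ, pow_succ, div_le_div_iff₀ (by positivity) (by positivity)]
      linarith
  refine hxy.trans ?_
  have h1 : maxLength a n ^ s ≤ |g x - g y| ^ s :=
    Real.rpow_le_rpow (ha.maxLength_pos n).le hfind hs.le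
  have h2 := hck n
  rw [stepSum] at h2
  rw [div_mul_eq_mul_div, div_le_div_iff₀ (by positivity) hc]
  nlinarith [mul_le_mul_of_nonneg_left h1 (show (0 : ℝ) ≤ 2 ^ n by positivity)]

/-- The inverse of the coding maps a subset of the Cantor set onto `[0, 1)`, of dimension `1`, and
an `s`-Hölder map multiplies dimension by at most `1 / s`. -/
theorem IsGapSequence.le_dimH_of_le_stepSum (ha : IsGapSequence a) (u : ℝ) {s : ℝ≥0} (hs : 0 < s)
    (h : ∃ c > 0, ∀ᶠ k in atTop, c ≤ stepSum a s k) : (s : ℝ≥0∞) ≤ dimH (cantorSet u a) := by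
  obtain ⟨c, hc, hck⟩ := ha.exists_forall_le_stepSum h
  obtain ⟨g, hgC, hg⟩ := ha.exists_coding u
  have hinj : Set.InjOn g (Set.Ico 0 1) := fun x hx y hy => ha.eq_of_coding_eq hg hx hy
  set f := Function.invFunOn g (Set.Ico 0 1)
  have hf : ∀ y ∈ Set.Ico (0 : ℝ) 1, f (g y) = y := fun y hy => hinj.leftInvOn_invFunOn hy
  have hholder : HolderOnWith (Real.toNNReal (8 / c)) s f (g '' Set.Ico 0 1) := by
    rintro _ ⟨x, hx, rfl⟩ _ ⟨y, hy, rfl⟩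
    rw [hf x hx, hf y hy, edist_dist, edist_dist, Real.dist_eq, Real.dist_eq,
      ENNReal.ofReal_rpow_of_nonneg (abs_nonneg _) s.coe_nonneg]
    change _ ≤ ENNReal.ofReal (8 / c) * _
    rw [← ENNReal.ofReal_mul (by positivity)]
    exact ENNReal.ofReal_le_ofReal (ha.abs_sub_le_rpow hg (by exact_mod_cast hs) hc hck hx hy)
  have himage : f '' (g '' Set.Ico 0 1) = Set.Ico 0 1 := by
    rw [Set.image_image]
    exact (Set.image_congr hf).trans (Set.image_id' _)
  have hdim : dimH (Set.Ico (0 : ℝ) 1) = 1 := by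
    simpa using Real.dimH_of_nonempty_interior (s := Set.Ico (0 : ℝ) 1) (by simp)
  have h1 := hholder.dimH_image_le hs
  rw [himage, hdim, ENNReal.le_div_iff_mul_le (by simp [hs.ne']) (by simp), one_mul] at h1
  exact h1.trans (dimH_mono (Set.image_subset_iff.2 hgC))

end Hausdorff

/-! ### Packing measure through `stepSum`. -/

section Packing

variable {a : ℕ → ℝ} {u : ℝ}

theorem packingPremeasure_empty (h : ℝ → ℝ≥0∞) : packingPremeasure h ∅ = 0 := by
  refine le_antisymm (iInf₂_le_of_le 1 one_pos (iSup₂_le fun T hT => ?_)) zero_le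
  have : IsEmpty T := ⟨fun p => (hT.1 p p.2).1⟩
  simp

theorem packingMeasure_le_packingPremeasure (h : ℝ → ℝ≥0∞) (E : Set ℝ) :
    packingMeasure h E ≤ packingPremeasure h E := by
  refine iInf₂_le_of_le (fun i : ℕ => if i = 0 then E else ∅) ?_ ?_
  · ext x
    simp
  · rw [tsum_eq_single 0 fun i hi => by simp [hi, packingPremeasure_empty]]
    simp

theorem IsGapSequence.exists_stepInterval_subset_ball (ha : IsGapSequence a) {x ρ : ℝ}
    (hx : x ∈ cantorSet u a) {k : ℕ} (hk : maxLength a k < ρ) :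
    ∃ j < 2 ^ k, stepInterval u a k j ⊆ Metric.ball x ρ := by
  obtain ⟨j, hj, hxj⟩ := mem_cantorSet_iff.1 hx k
  refine ⟨j, hj, fun y hy => ?_⟩
  have := ha.intervalLength_le_maxLength k j
  rw [Metric.mem_ball, Real.dist_eq, abs_lt]
  constructor <;> linarith [hxj.1, hxj.2, hy.1, hy.2]

theorem floor_mul_two_pow_eq {y : ℝ} {k j : ℕ}
    (hy : y ∈ Set.Ico ((j : ℝ) / 2 ^ k) ((j + 1) / 2 ^ k)) : ⌊y * 2 ^ k⌋₊ = j := by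
  have hp : (0 : ℝ) < 2 ^ k := by positivity
  rw [Nat.floor_eq_iff (mul_nonneg ((by positivity : (0 : ℝ) ≤ j / 2 ^ k).trans hy.1) hp.le)]
  exact ⟨(div_le_iff₀ hp).1 hy.1, (lt_div_iff₀ hp).1 hy.2⟩

/-- The sum of the lengths of the dyadic intervals coded into disjoint sets is at most `1`. -/
theorem IsGapSequence.tsum_two_pow_le_one (ha : IsGapSequence a) {ι : Type*} {V : ι → Set ℝ}
    (hV : Pairwise (Function.onFun Disjoint V)) (k j : ι → ℕ) (hj : ∀ i, j i < 2 ^ k i)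
    (hsub : ∀ i, stepInterval u a (k i) (j i) ⊆ V i) :
    ∑' i, ENNReal.ofReal (1 / 2 ^ k i) ≤ 1 := by
  obtain ⟨g, -, hg⟩ := ha.exists_coding u
  let D : ι → Set ℝ := fun i => Set.Ico ((j i : ℝ) / 2 ^ k i) ((j i + 1) / 2 ^ k i)
  have hD : ∀ i, ∀ y ∈ D i, g y ∈ V i := fun i y hy => by
    have := hg y (k i)
    rw [floor_mul_two_pow_eq hy] at this
    exact hsub i this
  have hdisj : Pairwise (Function.onFun Disjoint D) := fun i i' hii' =>
    Set.disjoint_left.2 fun y hy hy' =>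
      Set.disjoint_left.1 (hV hii') (hD i y hy) (hD i' y hy')
  have hvol : ∀ i, volume (D i) = ENNReal.ofReal (1 / 2 ^ k i) := fun i => by
    rw [Real.volume_Ico]; congr 1; ring
  have hunion : ⋃ i, D i ⊆ Set.Ico (0 : ℝ) 1 := by
    refine Set.iUnion_subset fun i => Set.Ico_subset_Ico (by positivity) ?_
    rw [div_le_one (by positivity)]
    exact_mod_cast hj i
  calc ∑' i, ENNReal.ofReal (1 / 2 ^ k i) = ∑' i, volume (D i) := by simp_rw [hvol]
    _ ≤ volume (⋃ i, D i) :=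
      tsum_meas_le_meas_iUnion_of_disjoint volume (fun i => measurableSet_Ico) hdisj
    _ ≤ volume (Set.Ico (0 : ℝ) 1) := measure_mono hunion
    _ = 1 := by simp

/-- A ball with radius in `(L_{k+1}, L_k]` contains an interval of step `k + 1` and contributes at
most a constant times `2 ^ -(k + 1)`. The balls are disjoint, so these dyadic weights sum to at most
`1`. -/
theorem IsGapSequence.packingMeasure_ne_top (ha : IsGapSequence a) {s : ℝ} (hs : 0 < s)
    (h : BddAbove (Set.range (stepSum a s))) :
    packingMeasure (fun x => ENNReal.ofReal (x ^ s)) (cantorSet u a) ≠ ∞ := by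
  obtain ⟨M, hM⟩ := h
  have hM' : ∀ k, stepSum a s k ≤ M := fun k => hM ⟨k, rfl⟩
  have hM0 : 0 ≤ M := (ha.stepSum_pos s 0).le.trans (hM' 0)
  suffices hle : packingPremeasure (fun x => ENNReal.ofReal (x ^ s)) (cantorSet u a) ≤
      ENNReal.ofReal (2 ^ s * 2 * M) from
    (((packingMeasure_le_packingPremeasure _ _).trans hle).trans_lt ENNReal.ofReal_lt_top).ne
  -- With this `δ` every radius is below `maxLength a 0`, which rules out the first index in the
  -- search for `k`.
  refine iInf₂_le_of_le (maxLength a 0) (ha.maxLength_pos 0) (iSup₂_le fun T hT => ?_)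
  have hk : ∀ p : T, ∃ k, maxLength a (k + 1) < p.1.2 ∧ p.1.2 ≤ maxLength a k := by
    intro p
    obtain ⟨-, hp0, hp1⟩ := hT.1 p p.2
    classical
    have hex : ∃ k, maxLength a k < p.1.2 := (ha.tendsto_maxLength.eventually_lt_const hp0).exists
    have hfind := Nat.find_spec hex
    have hmin := fun m => Nat.find_min hex (m := m)
    generalize Nat.find hex = n at hfind hmin
    rcases n with _ | n
    · linarith
    · exact ⟨n, hfind, not_lt.1 (hmin n (by omega))⟩
  choose k hk1 hk2 using hk
  choose j hj hsub using fun p : T =>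
    ha.exists_stepInterval_subset_ball (hT.1 p p.2).1 (hk1 p)
  have hdisj : Pairwise (Function.onFun Disjoint fun p : T => Metric.ball p.1.1 p.1.2) :=
    fun p q hpq => hT.2 p.2 q.2 fun h => hpq (Subtype.ext h)
  calc ∑' p : T, ENNReal.ofReal ((2 * p.1.2) ^ s)
      ≤ ∑' p : T, ENNReal.ofReal (2 ^ s * 2 * M) * ENNReal.ofReal (1 / 2 ^ (k p + 1)) := by
        refine ENNReal.tsum_le_tsum fun p => ?_
        rw [← ENNReal.ofReal_mul (by positivity)]
        refine ENNReal.ofReal_le_ofReal ?_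
        have hp0 := (hT.1 p p.2).2.1
        have h1 := Real.rpow_le_rpow hp0.le (hk2 p) hs.le
        have h2 : maxLength a (k p) ^ s ≤ M / 2 ^ k p := by
          rw [le_div_iff₀ (by positivity), mul_comm]
          exact hM' (k p)
        rw [Real.mul_rpow zero_le_two hp0.le]
        calc (2 : ℝ) ^ s * p.1.2 ^ s ≤ 2 ^ s * (M / 2 ^ k p) := by
              gcongr; exact h1.trans h2
          _ = 2 ^ s * 2 * M * (1 / 2 ^ (k p + 1)) := by rw [pow_succ]; field_simp
    _ = ENNReal.ofReal (2 ^ s * 2 * M) * ∑' p : T, ENNReal.ofReal (1 / 2 ^ (k p + 1)) :=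
        ENNReal.tsum_mul_left
    _ ≤ ENNReal.ofReal (2 ^ s * 2 * M) * 1 := by
        gcongr
        exact ha.tsum_two_pow_le_one hdisj _ j hj hsub
    _ = _ := mul_one _

/-- The Baire category argument: one of countably many sets that cover the Cantor set meets all
intervals of later steps inside a certain interval. -/
theorem IsGapSequence.exists_forall_inter_nonempty (ha : IsGapSequence a) {F : ℕ → Set ℝ}
    (hF : cantorSet u a = ⋃ i, F i) :
    ∃ i k j, j < 2 ^ k ∧
      ∀ d j', j' / 2 ^ d = j → (F i ∩ stepInterval u a (k + d) j').Nonempty := by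
  by_contra! hcon
  -- Otherwise every interval has, for each `i`, a descendant that misses `F i`. Avoiding `F 0`, `F
  -- 1`, … in turn leads to a point of the Cantor set in no `F i`.
  have hstep : ∀ (i : ℕ) (p : {p : ℕ × ℕ // p.2 < 2 ^ p.1}), ∃ q : {p : ℕ × ℕ // p.2 < 2 ^ p.1},
      stepInterval u a q.1.1 q.1.2 ⊆ stepInterval u a p.1.1 p.1.2 ∧
        F i ∩ stepInterval u a q.1.1 q.1.2 = ∅ := by
    rintro i ⟨⟨k, j⟩, hj⟩
    obtain ⟨d, j', rfl, he⟩ := hcon i k j hj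
    refine ⟨⟨⟨k + d, j'⟩, ?_⟩, ha.stepInterval_add_subset k d j', he⟩
    have := (Nat.div_lt_iff_lt_mul (by positivity)).1 hj
    simpa [pow_add] using this
  choose next hnext hempty using hstep
  let node : ℕ → {p : ℕ × ℕ // p.2 < 2 ^ p.1} := fun n =>
    Nat.rec ⟨(0, 0), by simp⟩ (fun i p => next i p) n
  obtain ⟨x, hx⟩ := IsCompact.nonempty_iInter_of_sequence_nonempty_isCompact_isClosed
    (fun n => cantorSet u a ∩ stepInterval u a (node n).1.1 (node n).1.2)
    (fun n => Set.inter_subset_inter_right _ (hnext n (node n)))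
    (fun n => ha.cantorSet_inter_stepInterval_nonempty (node n).2)
    ((isCompact_stepInterval _ _).inter_left isClosed_cantorSet)
    (fun n => isClosed_cantorSet.inter isClosed_Icc)
  rw [Set.mem_iInter] at hx
  obtain ⟨i, hi⟩ := Set.mem_iUnion.1 (hF ▸ (hx 0).1)
  exact Set.notMem_empty x (hempty i (node i) ▸ ⟨hi, (hx (i + 1)).2⟩)

/-- Points of `E` in every other interval of step `k + d + 1` inside the given one are centres of `2
^ d` disjoint balls of diameter `l = L_{k+d+2}`. Their sum `2 ^ d * l ^ s` is `stepSum` at `k + 2 +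
d` divided by `2 ^ (k + 2)`, which explains the threshold in `hfreq`. -/
theorem IsGapSequence.packingPremeasure_eq_top (ha : IsGapSequence a) {s : ℝ}
    (h : ¬ BddAbove (Set.range (stepSum a s))) {E : Set ℝ} {k j : ℕ} (hj : j < 2 ^ k)
    (hE : ∀ d j', j' / 2 ^ d = j → (E ∩ stepInterval u a (k + d) j').Nonempty) :
    packingPremeasure (fun x => ENNReal.ofReal (x ^ s)) E = ∞ := by
  refine iInf₂_eq_top.2 fun δ hδ => ENNReal.eq_top_of_forall_nnreal_le fun M => ?_
  have hfreq : ∃ᶠ n in atTop, (M : ℝ) * 2 ^ (k + 2) < stepSum a s n := by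
    intro hev
    exact h (IsBoundedUnder.bddAbove_range
      ⟨(M : ℝ) * 2 ^ (k + 2), eventually_map.2 (hev.mono fun n hn => not_lt.1 hn)⟩)
  obtain ⟨n, ⟨hnk, hnδ⟩, hnM⟩ := (((eventually_ge_atTop (k + 2)).and
    (ha.tendsto_maxLength.eventually_lt_const hδ)).and_frequently hfreq).exists
  obtain ⟨d, rfl⟩ := Nat.exists_eq_add_of_le hnk
  -- Only even offsets are used, so that a full interval separates any two chosen points.
  have hidx : ∀ i : Fin (2 ^ d), (j * 2 ^ (d + 1) + 2 * i) / 2 ^ (d + 1) = j := fun i => by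
    have := i.2
    rw [mul_comm, Nat.mul_add_div (by positivity), Nat.div_eq_of_lt (by rw [pow_succ]; omega),
      add_zero]
  have hlt : ∀ i : Fin (2 ^ d), j * 2 ^ (d + 1) + 2 * i < 2 ^ (k + (d + 1)) := fun i => by
    rw [pow_add 2 k (d + 1)]
    exact (Nat.div_lt_iff_lt_mul (k := 2 ^ (d + 1)) (by positivity)).1 ((hidx i).trans_lt hj)
  choose p hpE hpI using fun i : Fin (2 ^ d) => hE (d + 1) _ (hidx i)
  set l := maxLength a (k + 2 + d) with hl
  have hlpos : 0 < l := ha.maxLength_pos _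
  have hl' : l = maxLength a (k + (d + 1) + 1) := by rw [hl]; congr 1; omega
  have hdist : ∀ i i' : Fin (2 ^ d), i < i' → l ≤ p i' - p i := fun i i' hii' => by
    rw [hl']
    have : (i : ℕ) < i' := hii'
    exact ha.maxLength_le_sub (by omega) (hlt i') (hpI i) (hpI i')
  have hdisj : ∀ i i' : Fin (2 ^ d), i < i' →
      Disjoint (Metric.ball (p i) (l / 2)) (Metric.ball (p i') (l / 2)) := fun i i' hii' => by
    refine Metric.ball_disjoint_ball ?_
    rw [add_halves, dist_comm, Real.dist_eq]
    exact (hdist i i' hii').trans (le_abs_self _)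
  have hinj : Function.Injective fun i => (p i, l / 2) := by
    intro i i' hii'
    have hp : p i = p i' := congrArg Prod.fst hii'
    rcases lt_trichotomy i i' with hlt | heq | hlt
    · linarith [hdist _ _ hlt]
    · exact heq
    · linarith [hdist _ _ hlt]
  have hT : IsPacking δ E (Set.range fun i => (p i, l / 2)) := by
    constructor
    · rintro _ ⟨i, rfl⟩
      refine ⟨hpE i, by positivity, ?_⟩
      dsimp only
      linarith
    · rintro _ ⟨i, rfl⟩ _ ⟨i', rfl⟩ hne
      rcases lt_trichotomy i i' with hlt | heq | hlt
      · exact hdisj _ _ hlt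
      · exact absurd (by rw [heq]) hne
      · exact (hdisj _ _ hlt).symm
  refine le_iSup₂_of_le _ hT ?_
  rw [tsum_range (fun q : ℝ × ℝ => ENNReal.ofReal ((2 * q.2) ^ s)) hinj, tsum_fintype]
  simp only [mul_div_cancel₀ l two_ne_zero, Finset.sum_const, Finset.card_univ, Fintype.card_fin,
    nsmul_eq_mul]
  rw [← ENNReal.ofReal_natCast, ← ENNReal.ofReal_mul (by positivity),
    ← ENNReal.ofReal_coe_nnreal]
  refine ENNReal.ofReal_le_ofReal ?_
  rw [stepSum, ← hl, pow_add 2 (k + 2) d] at hnM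
  have : (M : ℝ) * 2 ^ (k + 2) < 2 ^ d * l ^ s * 2 ^ (k + 2) := by linarith
  push_cast
  exact (lt_of_mul_lt_mul_right this (by positivity)).le

theorem IsGapSequence.packingMeasure_eq_top (ha : IsGapSequence a) (u : ℝ) {s : ℝ}
    (h : ¬ BddAbove (Set.range (stepSum a s))) :
    packingMeasure (fun x => ENNReal.ofReal (x ^ s)) (cantorSet u a) = ∞ := by
  refine iInf₂_eq_top.2 fun F hF => ?_
  obtain ⟨i, k, j, hj, hE⟩ := ha.exists_forall_inter_nonempty hF
  exact ENNReal.tsum_eq_top_of_eq_top ⟨i, ha.packingPremeasure_eq_top h hj hE⟩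

end Packing

/-! ### Comparison of two sequences. -/

section Comparison

variable {a b : ℕ → ℝ}

theorem IsGapSequence.stepSum_add_le (ha : IsGapSequence a) {s : ℝ} (hs : 0 ≤ s) {m k : ℕ}
    (h : maxLength a (k + m) ≤ maxLength b k) : stepSum a s (k + m) ≤ 2 ^ m * stepSum b s k := by
  rw [stepSum, stepSum, pow_add, mul_comm ((2 : ℝ) ^ k), mul_assoc]
  gcongr
  exact (ha.maxLength_pos _).le

theorem IsGapSequence.dimH_le_of_maxLength_le (ha : IsGapSequence a) (hb : IsGapSequence b)
    (u v : ℝ) {m : ℕ} (h : ∀ᶠ k in atTop, maxLength a (k + m) ≤ maxLength b k) :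
    dimH (cantorSet u a) ≤ dimH (cantorSet v b) := by
  refine le_of_forall_lt fun t ht => ?_
  obtain ⟨s, hts, hs⟩ := ENNReal.lt_iff_exists_nnreal_btwn.1 ht
  have hs0 : 0 < s := by exact_mod_cast zero_le.trans_lt hts
  refine hts.trans_le (hb.le_dimH_of_le_stepSum v hs0 ?_)
  obtain ⟨c, hc, hck⟩ := ha.exists_le_stepSum_of_hausdorffMeasure_ne_zero s.coe_nonneg
    (by rw [hausdorffMeasure_of_lt_dimH hs]; exact ENNReal.top_ne_zero)
  refine ⟨c / 2 ^ m, by positivity, ?_⟩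
  filter_upwards [h, (tendsto_add_atTop_nat m).eventually hck] with k hk hck
  rw [div_le_iff₀' (by positivity)]
  exact hck.trans (ha.stepSum_add_le s.coe_nonneg hk)

theorem IsGapSequence.packingDim_le_of_maxLength_le (ha : IsGapSequence a) (hb : IsGapSequence b)
    (u v : ℝ) {m : ℕ} (h : ∀ᶠ k in atTop, maxLength a (k + m) ≤ maxLength b k) :
    packingDim (cantorSet u a) ≤ packingDim (cantorSet v b) := by
  refine iSup_mono fun s => iSup_mono fun hs => iSup_mono' fun htop => ⟨?_, le_rfl⟩
  -- By contraposition: boundedness of `stepSum b s` passes to `stepSum a s` and would make the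
  -- packing measure of `C_a` finite.
  refine hb.packingMeasure_eq_top v fun hbdd => ?_
  refine ha.packingMeasure_ne_top (u := u) (s := s) (by exact_mod_cast hs) ?_ htop
  obtain ⟨M, hM⟩ := hbdd
  refine IsBoundedUnder.bddAbove_range ⟨2 ^ m * M, ?_⟩
  rw [eventually_map, ← map_add_atTop_eq_nat m, eventually_map]
  filter_upwards [h] with k hk
  refine (ha.stepSum_add_le s.coe_nonneg hk).trans ?_
  gcongr
  exact hM ⟨k, rfl⟩

/-- Let `x` and `y` be the average lengths for `a` at step `k + m` and for `b` at step `k`. If `y <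
x`, then `2^{-k} ≲ h_b y ≲ h_a y ≤ h_a x ≲ 2^{-(k+m)}`, which fails once `2 ^ m` exceeds the product
of the constants. -/
theorem IsGapSequence.exists_maxLength_le (ha : IsGapSequence a) (hb : IsGapSequence b) {A B : ℝ}
    {h_a h_b : ℝ → ℝ≥0∞} (hha : IsAssociated A h_a a) (hhb : IsAssociated B h_b b)
    (hab : Dominated (Set.Ioc 0 (min A B)) h_b h_a) :
    ∃ m, ∀ᶠ k in atTop, maxLength a (k + m) ≤ maxLength b k := by
  obtain ⟨c, hc, hca⟩ := hha.equivalent.1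
  obtain ⟨c', hc', hcb⟩ := hhb.equivalent.2
  obtain ⟨e, he, hcab⟩ := hab
  have hApos : 0 < min A B :=
    lt_min ((ha.tail_pos le_rfl).trans_le hha.domain) ((hb.tail_pos le_rfl).trans_le hhb.domain)
  have hcast : ∀ k : ℕ, ((2 ^ k : ℕ) : ℝ) = 2 ^ k := fun k => by push_cast; rfl
  obtain ⟨m, hm⟩ := pow_unbounded_of_one_lt (c' * e * c) (one_lt_two (α := ℝ≥0))
  -- The extra step pays for `maxLength a (k + m + 1) ≤ x`.
  refine ⟨m + 1, ?_⟩
  -- For large `k` the point `y` lies in the common domain, where `h_b` and `h_a` can be compared;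
  -- `x` only has to lie in the domain of `h_a`.
  filter_upwards [hb.tendsto_tail_div.eventually_le_const hApos] with k hk
  refine (ha.maxLength_succ_le_tail (k + m)).trans (le_trans ?_ (hb.tail_le_maxLength k))
  set x := tail a (2 ^ (k + m)) / 2 ^ (k + m)
  set y := tail b (2 ^ k) / 2 ^ k
  have hy0 : 0 < y := div_pos (hb.tail_pos Nat.one_le_two_pow) (by positivity)
  have hxA : x ≤ A := by
    refine le_trans ?_ hha.domain
    refine (div_le_self (ha.tail_pos Nat.one_le_two_pow).le ?_).trans
      (ha.tail_le_tail_one Nat.one_le_two_pow)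
    exact one_le_pow₀ one_le_two
  by_contra! hlt
  have hmono := hha.increasing ⟨hy0, hk.trans (min_le_left _ _)⟩ ⟨hy0.trans hlt, hxA⟩ hlt
  have h1 := hca (2 ^ (k + m)) Nat.one_le_two_pow
  have h2 := hcb (2 ^ k) Nat.one_le_two_pow
  have h3 := hcab y ⟨hy0, hk⟩
  simp only [hcast] at h1 h2
  have h4 : ((2 ^ k : ℕ) : ℝ≥0∞)⁻¹ ≤ c' * (e * (c * ((2 ^ (k + m) : ℕ) : ℝ≥0∞)⁻¹)) := by
    refine h2.trans (mul_le_mul_right (h3.trans (mul_le_mul_right (hmono.le.trans h1) _)) _)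
  have h5 : ((2 : ℝ≥0) ^ k)⁻¹ ≤ c' * (e * (c * ((2 : ℝ≥0) ^ (k + m))⁻¹)) := by
    rw [← ENNReal.coe_le_coe]
    push_cast [ENNReal.coe_inv (pow_ne_zero _ (two_ne_zero (α := ℝ≥0)))]
    simpa using h4
  have h6 : (2 : ℝ≥0) ^ m ≤ c' * e * c := by
    have := mul_le_mul_left h5 ((2 : ℝ≥0) ^ (k + m))
    rw [pow_add] at this
    field_simp at this
    simpa [mul_comm, mul_left_comm, mul_assoc] using this
  exact absurd h6 (not_le.2 hm)

end Comparison

end GapCantor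

theorem mainTheorem8 (a b : ℕ → ℝ)
    (ha : GapCantor.IsGapSequence a) (hb : GapCantor.IsGapSequence b)
    (A B : ℝ) (h_a h_b : ℝ → ℝ≥0∞)
    (hha : GapCantor.IsAssociated A h_a a) (hhb : GapCantor.IsAssociated B h_b b)
    (hab : GapCantor.Equivalent (Set.Ioc 0 (min A B)) h_a h_b) (u v : ℝ) :
    dimH (GapCantor.cantorSet u a) = dimH (GapCantor.cantorSet v b) ∧
      GapCantor.packingDim (GapCantor.cantorSet u a) =
        GapCantor.packingDim (GapCantor.cantorSet v b) := by
  obtain ⟨m, hm⟩ := ha.exists_maxLength_le hb hha hhb hab.2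
  obtain ⟨m', hm'⟩ := hb.exists_maxLength_le ha hhb hha (by rw [min_comm]; exact hab.1)
  exact ⟨le_antisymm (ha.dimH_le_of_maxLength_le hb u v hm)
      (hb.dimH_le_of_maxLength_le ha v u hm'),
    le_antisymm (ha.packingDim_le_of_maxLength_le hb u v hm)
      (hb.packingDim_le_of_maxLength_le ha v u hm')⟩
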